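/- **Model.** Fix constants $\lambda,\nu,q,\tau>0$, $\bar V\in\mathbb N$, $\bar w\ge 0$, integers $1\le F\le h$ and $k\ge 2$. A network has a finite space of at most $\bar V$ network IDs, a set $\mathcal V(t)$ of nodes that may grow with time $t\ge 0$, undirected peer connections forming a connected graph on $\mathcal V(t)$ at every time, and one additional agent node $a$. All these objects may be random. * *Peering.* Every node has at most $h$ peer connections, and among these at least $F$ dynamic slots. The agent has at most $k$ peers, all of its own choosing, and can request a connection to a node only after learning its network ID. It repeats its requests at arbitrarily high frequency and slots are filled first come, first served: as long as the agent requests $v$ without being its peer, all dynamic slots of $v$ are occupied by connections to other nodes, established no later than the time of the request. Thus the agent gets the first slot that becomes free, and regains it at once if the connection is torn down. A connection to the agent otherwise ends only when the agent withdraws its request. * *Messages.* Each link has a constant latency $w(x,y)\in(0,\bar w]$ for $x\ne y$ (agent included), satisfying the triangle inequality $w(x,y)\le w(x,z)+w(z,y)$. Messages are flooded: a node forwards a message at the moment of its first receipt to its current peers, and a copy sent from $x$ to $y$ takes time $w(x,y)$. The agent does not relay. For each received message, the agent observes the logical ID of its sender, the arrival time and the peer that delivered it first (a copy coming directly from the sender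 counts as first if it arrives simultaneously with relayed copies). A logical ID $u$ belongs to a node $\mathrm{NID}(u)$; the map $\mathrm{NID}$ is unknown to the agent. * *Oracle.* A query takes time $\tau$, and the agent has at most one pending query at a time. The answer is the network ID of an existing node; conditionally on the earlier answers, each node of the network is drawn with probability at least $q$. * *Liveness.* The network is $(\lambda,\nu)$-live with respect to a set $U$ of targets: (I) dynamic connections have duration $\mathrm{Exp}(\lambda)$ (unless ended earlier by the agent), independent of the time at which they are established and of whether they are established by the agent; (II) for each $u\in U$, the messages of $u$ form a Poisson process of rate $\nu$. **Peri-like strategy.** Time is divided into rounds of fixed length, and a fixed number of consecutive rounds is devoted to each target in turn. In each round, the agent draws $k-1$ network IDs from the oracle, and after an initial waiting time it listens for the first new message of the current target. At the end of the round it keeps only the peer that delivered this message first (or the previously kept one if there was no such message) and requests connections to the $k-1$ drawn nodes in place of the other peers. The peer kept at the end of the rounds of a target is announced as its network ID. Finally, the agent requests connections to all announced nodes if there are at most $k$ of them. **Theorem.** For every $\varepsilon_0<1$ there is a constant $C$, depending only on $\varepsilon_0$ and the constants of the model, such that for every $r\ge1$ and every $\varepsilon\in(0,\varepsilon_0]$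 the round length, the waiting time and the number of rounds of the Peri-like strategy can be chosen such that it ends at a time $$T\le C\,r^2\,\varepsilon^{-1}\log^2(\varepsilon^{-1})$$ and the following holds. In every $(\lambda,\nu)$-live network as above with a set $U$ of $|U|=r$ target logical IDs that belong to distinct nodes present from time $0$ on, if the agent follows this strategy, then with probability at least $1-\varepsilon$ the agent announces by time $T$ the correct network ID $\mathrm{NID}(u)$ of every target $u\in U$ and, provided that $|U|\le k$, is at time $T$ a peer of all the targets. -/

import Mathlib

open MeasureTheory ProbabilityTheory
open scoped NNReal ENNReal

noncomputable section

/-- The numerical constants of the model. -/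
structure NetParams where
  /-- dynamic connections last an `Exp(lam)` time -/
  lam : ℝ
  /-- every target broadcasts according to a Poisson process of rate `nu` -/
  nu : ℝ≥0
  /-- lower bound for the probability that the oracle draws a given node of the network -/
  q : ℝ≥0
  /-- time that the oracle needs to process one query -/
  tau : ℝ≥0
  /-- upper bound for the number of network IDs -/
  maxNodes : ℕ
  /-- upper bound for the link latencies -/
  maxLatency : ℝ≥0
  /-- upper bound for the number of peer connections of a node -/
  h : ℕ
  /-- lower bound for the number of dynamic peer slots of a node -/
  F : ℕ
  /-- upper bound for the number of peer connections of the agent -/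
  k : ℕ
  lam_pos : 0 < lam
  nu_pos : 0 < nu
  q_pos : 0 < q
  tau_pos : 0 < tau
  F_pos : 0 < F
  F_le : F ≤ h
  two_le_k : 2 ≤ k

/-- The objects that make up a time-varying network together with one agent node, on the
sample space `Ω`. `V` is the space of network IDs of the nodes other than the agent, `L` is the
space of logical IDs, and time is `ℝ≥0`. In `Option V`, the value `none` stands for the agent.

The dynamic slots of a node `v` are numbered by `Fin (slots v)`, and the successive connections
occupying the slot `i` of `v` are numbered by `ℕ` (a connection that never comes about has
starting time `∞`). -/
structure NetworkData (V L Ω : Type*) where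
  /-- the (unknown) map from logical IDs to network IDs -/
  NID : L → V
  /-- link latency -/
  w : Option V → Option V → ℝ≥0
  /-- the nodes present at a given time -/
  nodes : ℝ≥0 → Ω → Set V
  /-- the peer connections between nodes other than the agent -/
  graph : ℝ≥0 → Ω → SimpleGraph V
  /-- the number of dynamic slots of a node -/
  slots : V → ℕ
  /-- the time at which the `n`-th connection in a dynamic slot is established -/
  start : (v : V) → Fin (slots v) → ℕ → Ω → ℝ≥0∞
  /-- the random duration of that connection -/
  lifetime : (v : V) → Fin (slots v) → ℕ → Ω → ℝ
  /-- the time at which that connection ends -/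
  finish : (v : V) → Fin (slots v) → ℕ → Ω → ℝ≥0∞
  /-- the peer at the other end of that connection (`none` is the agent) -/
  occupant : (v : V) → Fin (slots v) → ℕ → Ω → Option V
  /-- the nodes with which the agent requests (repeatedly) to be connected at a given time -/
  requests : ℝ≥0 → Ω → Finset V
  /-- the number of messages signed by a logical ID that were broadcast up to a given time -/
  M : L → ℝ≥0 → Ω → ℕ
  /-- the time at which a node receives the `m`-th message of a logical ID for the first time -/
  reception : L → ℕ → Ω → V → ℝ≥0∞
  /-- the peer that is the first to deliver the `m`-th message of a logical ID to the agent -/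
  firstPeer : L → ℕ → Ω → Option V
  /-- the answer of the oracle to the query that is submitted at a given time -/
  oracle : ℝ≥0 → Ω → V

namespace NetworkData

variable {V L Ω : Type*} (N : NetworkData V L Ω)

/-- The `n`-th connection in the slot `i` of `v` exists at time `t`. -/
def Alive (v : V) (i : Fin (N.slots v)) (n : ℕ) (t : ℝ≥0) (ω : Ω) : Prop :=
  N.start v i n ω ≤ t ∧ (t : ℝ≥0∞) < N.finish v i n ω

/-- The nodes that are peers of the agent at time `t`. -/
def peers (t : ℝ≥0) (ω : Ω) : Set V :=
  {v | ∃ i n, N.Alive v i n t ω ∧ N.occupant v i n ω = none}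

/-- The time at which the `m`-th message (`m = 0, 1, …`) of the logical ID `u` is broadcast. -/
def broadcastTime (u : L) (m : ℕ) (ω : Ω) : ℝ≥0∞ :=
  ⨅ (t : ℝ≥0) (_ : m < N.M u t ω), (t : ℝ≥0∞)

/-- The time at which the peer `v` delivers the `m`-th message of `u` to the agent: `v` forwards
the message when it receives it, provided that the agent is its peer at that moment. -/
def deliveryTime (u : L) (m : ℕ) (ω : Ω) (v : V) : ℝ≥0∞ :=
  ⨅ (t : ℝ≥0) (_ : N.reception u m ω v = t ∧ v ∈ N.peers t ω),
    ((t + N.w (some v) none : ℝ≥0) : ℝ≥0∞)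

/-- The time at which the agent receives the `m`-th message of `u` for the first time. -/
def firstArrival (u : L) (m : ℕ) (ω : Ω) : ℝ≥0∞ :=
  ⨅ v, N.deliveryTime u m ω v

end NetworkData

/-- The laws that the network obeys on every sample path. -/
structure IsP2PNetwork (P : NetParams) {V L Ω : Type*} [Fintype V] (N : NetworkData V L Ω) :
    Prop where
  card_le : Fintype.card V ≤ P.maxNodes
  w_pos : ∀ x y, x ≠ y → 0 < N.w x y
  w_le : ∀ x y, N.w x y ≤ P.maxLatency
  triangle : ∀ x y z, N.w x y ≤ N.w x z + N.w z y
  -- nodes may be spawned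
  nodes_mono : ∀ s t ω, s ≤ t → N.nodes s ω ⊆ N.nodes t ω
  graph_nodes : ∀ t ω u v, (N.graph t ω).Adj u v → u ∈ N.nodes t ω
  connected : ∀ t ω, ((N.graph t ω).induce (N.nodes t ω)).Connected
  degree_le : ∀ t ω v,
    ((N.graph t ω).neighborSet v).ncard + (N.peers t ω ∩ {v}).ncard ≤ P.h
  le_slots : ∀ v, P.F ≤ N.slots v
  slots_le : ∀ v, N.slots v ≤ P.h
  start_le_finish : ∀ v i n ω, N.start v i n ω ≤ N.finish v i n ω
  finish_le_start : ∀ v i n ω, N.finish v i n ω ≤ N.start v i (n + 1) ω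
  -- a dynamic connection between two nodes other than the agent is an edge, and it lasts for
  -- its lifetime
  adj_of_alive : ∀ v i n t ω u, N.Alive v i n t ω → N.occupant v i n ω = some u →
    (N.graph t ω).Adj v u
  finish_eq : ∀ v i n ω u, N.occupant v i n ω = some u →
    N.finish v i n ω = N.start v i n ω + ENNReal.ofReal (N.lifetime v i n ω)
  -- a connection to the agent exists only at the agent's request; it ends with its lifetime, or
  -- earlier if the agent withdraws the request
  agent_alive : ∀ v t ω, v ∈ N.peers t ω → v ∈ N.requests t ω ∧ v ∈ N.nodes t ω
  agent_finish_le : ∀ v i n ω, N.occupant v i n ω = none →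
    N.finish v i n ω ≤ N.start v i n ω + ENNReal.ofReal (N.lifetime v i n ω)
  agent_finish : ∀ v i n ω, N.occupant v i n ω = none →
    N.finish v i n ω < N.start v i n ω + ENNReal.ofReal (N.lifetime v i n ω) →
    ∃ t : ℝ≥0, N.finish v i n ω = t ∧ v ∉ N.requests t ω
  -- slots are given first come, first served, and the agent repeats its requests at arbitrarily
  -- high frequency: if the agent has been requesting `v` since time `s` and is not a peer of `v`
  -- at time `t`, then every dynamic slot of `v` is full, and since time `s` none of them has
  -- become free
  fcfs : ∀ v s t ω, s ≤ t → v ∈ N.nodes s ω → (∀ r ∈ Set.Icc s t, v ∈ N.requests r ω) →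
    v ∉ N.peers t ω →
    ∀ i, ∃ n, N.start v i n ω ≤ s ∧ (t : ℝ≥0∞) < N.finish v i n ω ∧ N.occupant v i n ω ≠ none
  -- the messages of each logical ID form a counting process
  M_zero : ∀ u ω, N.M u 0 ω = 0
  M_mono : ∀ u ω, Monotone fun t => N.M u t ω
  M_rightCont : ∀ u ω t, ContinuousWithinAt (fun t => N.M u t ω) (Set.Ici t) t
  -- flooding: a message starts at its sender, and each node forwards it to its neighbours at
  -- the moment of the first receipt
  reception_source : ∀ u m ω, N.reception u m ω (N.NID u) = N.broadcastTime u m ω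
  reception_flood : ∀ u m ω v, v ≠ N.NID u → N.reception u m ω v =
    ⨅ (p : V) (t : ℝ≥0) (_ : N.reception u m ω p = t ∧ (N.graph t ω).Adj p v),
      ((t + N.w (some p) (some v) : ℝ≥0) : ℝ≥0∞)
  -- the first delivery to the agent; when the copy that comes directly from the sender arrives
  -- simultaneously with relayed copies, it counts as the first one
  firstPeer_spec : ∀ u m ω v, N.firstPeer u m ω = some v →
    N.deliveryTime u m ω v = N.firstArrival u m ω
  firstPeer_isSome : ∀ u m ω, N.firstArrival u m ω ≠ ⊤ → N.firstPeer u m ω ≠ none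
  firstPeer_direct : ∀ u m ω, N.firstArrival u m ω ≠ ⊤ →
    N.deliveryTime u m ω (N.NID u) = N.firstArrival u m ω →
    N.firstPeer u m ω = some (N.NID u)
  oracle_mem : ∀ s ω, N.oracle s ω ∈ N.nodes s ω

/-- A Poisson process of rate `nu` on the time axis `ℝ≥0`. -/
structure IsPoissonProcess {Ω : Type*} [MeasurableSpace Ω] (nu : ℝ≥0) (M : ℝ≥0 → Ω → ℕ)
    (μ : Measure Ω) : Prop where
  measurable : ∀ t, Measurable (M t)
  zero : ∀ ω, M 0 ω = 0
  mono : ∀ ω, Monotone fun t => M t ω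
  rightCont : ∀ ω t, ContinuousWithinAt (fun t => M t ω) (Set.Ici t) t
  indep : HasIndepIncrements M μ
  law : ∀ s t, s ≤ t → HasLaw (fun ω => M t ω - M s ω) (poissonMeasure (nu * (t - s))) μ

/-- The information contained in the answers of the oracle that were given up to time `s`. -/
@[reducible] def NetworkData.oracleHistory {V L Ω : Type*} (P : NetParams) (N : NetworkData V L Ω)
    (s : ℝ≥0) : MeasurableSpace Ω :=
  ⨆ (r : ℝ≥0) (_ : r + P.tau ≤ s), MeasurableSpace.comap (N.oracle r) ⊤

/-- Whatever the oracle answered before, it draws each node of the network with probability at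
least `q`. -/
structure HasOracleLaw (P : NetParams) {V L Ω : Type*} [MeasurableSpace Ω]
    (N : NetworkData V L Ω) (μ : Measure Ω) : Prop where
  measurable : ∀ s v, MeasurableSet {ω | N.oracle s ω = v}
  le_draw : ∀ s v A, MeasurableSet[N.oracleHistory P s] A →
    (P.q : ℝ≥0∞) * μ (A ∩ {ω | v ∈ N.nodes s ω}) ≤ μ (A ∩ {ω | N.oracle s ω = v})

/-- A `(lam, nu)`-live network with target set `T`: the dynamic connections have durations
`Exp(lam)`, independent of the time at which they are established and of whether they are
established by the agent, and the messages of each target form a Poisson process of rate `nu`. -/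
structure IsLive {V L Ω : Type*} [MeasurableSpace Ω] (lam : ℝ) (nu : ℝ≥0)
    (N : NetworkData V L Ω) (T : Set L) (μ : Measure Ω) : Prop where
  measurable_start : ∀ v i n, Measurable (N.start v i n)
  measurable_occupant : ∀ v i n, Measurable fun ω => (N.occupant v i n ω).isNone
  lifetime_law : ∀ v i n, HasLaw (N.lifetime v i n) (expMeasure lam) μ
  lifetime_indep : ∀ v i n,
    IndepFun (N.lifetime v i n) (fun ω => (N.start v i n ω, (N.occupant v i n ω).isNone)) μ
  poisson : ∀ u ∈ T, IsPoissonProcess nu (N.M u) μ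

/-- What the agent gets to see: for each message, identified by the logical ID of its sender and
a serial number, the time of its first arrival and the peer that delivered it first; and the
answers of the oracle. -/
structure AgentView (V L : Type*) where
  arrival : L → ℕ → ℝ≥0∞
  firstPeer : L → ℕ → Option V
  answer : ℝ≥0 → V

/-- The agent's view along a sample path. -/
def NetworkData.view {V L Ω : Type*} (N : NetworkData V L Ω) (ω : Ω) : AgentView V L where
  arrival u m := N.firstArrival u m ω
  firstPeer u m := N.firstPeer u m ω
  answer s := N.oracle s ω

/-- Two views cannot be told apart at time `t` by an agent that submits queries at the times in
`Q`, each of which is answered after `tau`. -/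
def AgentView.AgreeUpTo {V L : Type*} (tau : ℝ≥0) (Q : Set ℝ≥0) (t : ℝ≥0)
    (x y : AgentView V L) : Prop :=
  (∀ u m, x.arrival u m ≤ t ∨ y.arrival u m ≤ t →
    x.arrival u m = y.arrival u m ∧ x.firstPeer u m = y.firstPeer u m) ∧
  ∀ s ∈ Q, s + tau ≤ t → x.answer s = y.answer s

/-- A strategy of an agent for finding `r` targets: it acts on its observations only, it
respects its peer budget, and it submits the next query only after the previous one has been
answered. -/
structure Strategy (P : NetParams) (V L : Type*) (r : ℕ) where
  queries : Set ℝ≥0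
  requests : AgentView V L → ℝ≥0 → Finset V
  /-- the time at which the strategy announces its findings -/
  horizon : ℝ≥0
  /-- the network IDs that it announces for the targets -/
  output : AgentView V L → Fin r → Option V
  queries_spaced : ∀ s ∈ queries, ∀ t ∈ queries, s < t → s + P.tau ≤ t
  budget : ∀ x t, (requests x t).card ≤ P.k
  requests_causal : ∀ x y t, x.AgreeUpTo P.tau queries t y → requests x t = requests y t
  output_causal : ∀ x y, x.AgreeUpTo P.tau queries horizon y → output x = output y

/-- The agent of the network `N` follows the strategy `σ`. -/
def Strategy.Follows {P : NetParams} {V L Ω : Type*} {r : ℕ} (σ : Strategy P V L r)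
    (N : NetworkData V L Ω) : Prop :=
  ∀ t ω, N.requests t ω = σ.requests (N.view ω) t

/-- The timing of the Peri-like strategy. Time is divided into rounds of length `len`, and
`rounds` consecutive rounds are devoted to each target. In each round the agent
ignores the messages that arrive before `warm` has elapsed. -/
structure PeriSchedule (P : NetParams) where
  rounds : ℕ
  len : ℝ≥0
  warm : ℝ≥0
  len_pos : 0 < len
  /-- there is enough time for `k - 1` queries in each round -/
  queries_le : ((P.k - 1 : ℕ) : ℝ≥0) * P.tau ≤ len

namespace Peri

variable {P : NetParams} {V L : Type*}

/-- The `m`-th message of `u` is the first among the messages of `u` that arrive in `[a, b)`. -/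
def FirstIn (x : AgentView V L) (u : L) (a b : ℝ≥0) (m : ℕ) : Prop :=
  x.arrival u m ∈ Set.Ico (a : ℝ≥0∞) b ∧
    ∀ m', x.arrival u m' ∈ Set.Ico (a : ℝ≥0∞) b → x.arrival u m ≤ x.arrival u m'

open Classical in
/-- The peer that delivered the first message of `u` arriving in `[a, b)`, if there is one. -/
def heard (x : AgentView V L) (u : L) (a b : ℝ≥0) : Option V :=
  if h : ∃ m, FirstIn x u a b m then x.firstPeer u h.choose else none

/-- The peer that is kept at the beginning of round `n`: in each round, keep the peer that
delivered the first new message of the current target (and the old one if there was none). -/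
def kept (S : PeriSchedule P) {r : ℕ} (tgt : Fin r → L) (x : AgentView V L) : ℕ → Option V
  | 0 => none
  | n + 1 =>
    if h : n / S.rounds < r then
      (heard x (tgt ⟨n / S.rounds, h⟩) (n * S.len + S.warm) ((n + 1) * S.len)).or
        (kept S tgt x n)
    else kept S tgt x n

open Classical in
/-- The `k - 1` addresses obtained from the oracle during round `n`. -/
def fresh (S : PeriSchedule P) (x : AgentView V L) (n : ℕ) : Finset V :=
  (Finset.range (P.k - 1)).image fun j : ℕ => x.answer (n * S.len + j * P.tau)

/-- The network ID announced for the target `i`: the peer that is kept at the end of the rounds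
devoted to it. -/
def found (S : PeriSchedule P) {r : ℕ} (tgt : Fin r → L) (x : AgentView V L) (i : Fin r) :
    Option V :=
  kept S tgt x ((i + 1) * S.rounds)

open Classical in
/-- The set of all network IDs that were announced, if it fits into the peer budget. -/
def finalRequests (S : PeriSchedule P) {r : ℕ} (tgt : Fin r → L) (x : AgentView V L) :
    Finset V :=
  if (Finset.univ.biUnion fun i => (found S tgt x i).toFinset).card ≤ P.k then
    Finset.univ.biUnion fun i => (found S tgt x i).toFinset
  else ∅

open Classical in
/-- The requests in round `n`: in round `0` the agent knows no address; in each of the following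
rounds, it requests the kept peer and the addresses obtained in the previous round; in the end
it requests all the nodes that it has found. -/
def roundRequests (S : PeriSchedule P) {r : ℕ} (tgt : Fin r → L) (x : AgentView V L) (n : ℕ) :
    Finset V :=
  if r * S.rounds ≤ n then finalRequests S tgt x
  else if n = 0 then ∅
  else (kept S tgt x n).toFinset ∪ fresh S x (n - 1)

/-- The times at which the oracle is queried: `k - 1` times in each round. -/
def queryTimes (S : PeriSchedule P) : Set ℝ≥0 :=
  {s | ∃ n j : ℕ, j < P.k - 1 ∧ s = n * S.len + j * P.tau}

theorem query_end_le (S : PeriSchedule P) (n j : ℕ) (hj : j < P.k - 1) :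
    n * S.len + j * P.tau + P.tau ≤ (n + 1) * S.len := by
  have h1 : ((j + 1 : ℕ) : ℝ≥0) * P.tau ≤ ((P.k - 1 : ℕ) : ℝ≥0) * P.tau := by
    gcongr
    exact hj
  have h2 := h1.trans S.queries_le
  push_cast at h2
  calc (n : ℝ≥0) * S.len + j * P.tau + P.tau = n * S.len + (j + 1) * P.tau := by ring
    _ ≤ n * S.len + S.len := by gcongr
    _ = (n + 1) * S.len := by ring

theorem heard_congr {Q : Set ℝ≥0} {tau t : ℝ≥0} {x y : AgentView V L}
    (hxy : x.AgreeUpTo tau Q t y) (u : L) (a b : ℝ≥0) (hb : b ≤ t) :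
    heard x u a b = heard y u a b := by
  have hbt : (b : ℝ≥0∞) ≤ t := by exact_mod_cast hb
  have key : ∀ m, x.arrival u m ∈ Set.Ico (a : ℝ≥0∞) b ∨
      y.arrival u m ∈ Set.Ico (a : ℝ≥0∞) b →
      x.arrival u m = y.arrival u m ∧ x.firstPeer u m = y.firstPeer u m := by
    rintro m (h | h)
    · exact hxy.1 u m (Or.inl (h.2.le.trans hbt))
    · exact hxy.1 u m (Or.inr (h.2.le.trans hbt))
  have hF : FirstIn x u a b = FirstIn y u a b := by
    funext m
    refine propext ⟨fun h => ?_, fun h => ?_⟩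
    · have e := (key m (Or.inl h.1)).1
      refine ⟨e ▸ h.1, fun m' hm' => ?_⟩
      have e' := (key m' (Or.inr hm')).1
      rw [← e, ← e']
      exact h.2 m' (e' ▸ hm')
    · have e := (key m (Or.inr h.1)).1
      refine ⟨e ▸ h.1, fun m' hm' => ?_⟩
      have e' := (key m' (Or.inl hm')).1
      rw [e, e']
      exact h.2 m' (e' ▸ hm')
  unfold heard
  by_cases h : ∃ m, FirstIn x u a b m
  · have h' : ∃ m, FirstIn y u a b m := hF ▸ h
    have hc : h.choose = h'.choose := by
      congr 1
    rw [dif_pos h, dif_pos h', ← hc]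
    exact (key _ (Or.inl h.choose_spec.1)).2
  · have h' : ¬ ∃ m, FirstIn y u a b m := hF ▸ h
    rw [dif_neg h, dif_neg h']

theorem kept_congr (S : PeriSchedule P) {r : ℕ} (tgt : Fin r → L) {Q : Set ℝ≥0} {tau t : ℝ≥0}
    {x y : AgentView V L} (hxy : x.AgreeUpTo tau Q t y) (n : ℕ) (hn : n * S.len ≤ t) :
    kept S tgt x n = kept S tgt y n := by
  induction n with
  | zero => rfl
  | succ n ih =>
    push_cast at hn
    have hn' : n * S.len ≤ t := le_trans (by gcongr; simp) hn
    simp only [kept, ih hn', heard_congr hxy _ _ _ hn]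

theorem fresh_congr (S : PeriSchedule P) {t : ℝ≥0}
    {x y : AgentView V L} (hxy : x.AgreeUpTo P.tau (queryTimes S) t y) (n : ℕ)
    (hn : (n + 1) * S.len ≤ t) : fresh S x n = fresh S y n := by
  classical
  unfold fresh
  refine Finset.image_congr fun j hj => ?_
  have hj' : j < P.k - 1 := by simpa using hj
  exact hxy.2 _ ⟨n, j, hj', rfl⟩ ((query_end_le S n j hj').trans hn)

theorem found_congr (S : PeriSchedule P) {r : ℕ} (tgt : Fin r → L) {Q : Set ℝ≥0}
    {tau t : ℝ≥0} {x y : AgentView V L} (hxy : x.AgreeUpTo tau Q t y)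
    (ht : ((r * S.rounds : ℕ) : ℝ≥0) * S.len ≤ t) (i : Fin r) :
    found S tgt x i = found S tgt y i := by
  refine kept_congr S tgt hxy _ (le_trans ?_ ht)
  gcongr
  exact i.2

theorem card_finalRequests (S : PeriSchedule P) {r : ℕ} (tgt : Fin r → L)
    (x : AgentView V L) : (finalRequests S tgt x).card ≤ P.k := by
  classical
  unfold finalRequests
  split_ifs with h
  · exact h
  · simp

theorem card_roundRequests (S : PeriSchedule P) {r : ℕ} (tgt : Fin r → L)
    (x : AgentView V L) (n : ℕ) : (roundRequests S tgt x n).card ≤ P.k := by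
  classical
  unfold roundRequests
  split_ifs
  · exact card_finalRequests S tgt x
  · simp
  · have h1 : (kept S tgt x n).toFinset.card ≤ 1 := by
      cases kept S tgt x n <;> simp
    have h2 : (fresh S x (n - 1)).card ≤ P.k - 1 :=
      Finset.card_image_le.trans (by simp)
    have h3 := P.two_le_k
    exact (Finset.card_union_le _ _).trans (by omega)

theorem roundRequests_congr (S : PeriSchedule P) {r : ℕ} (tgt : Fin r → L) {t : ℝ≥0}
    {x y : AgentView V L} (hxy : x.AgreeUpTo P.tau (queryTimes S) t y) (n : ℕ)
    (hn : n * S.len ≤ t) : roundRequests S tgt x n = roundRequests S tgt y n := by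
  unfold roundRequests
  split_ifs with h1 h2
  · have hf : found S tgt x = found S tgt y := by
      funext i
      refine found_congr S tgt hxy (le_trans ?_ hn) i
      gcongr
    simp only [finalRequests, hf]
  · rfl
  · have e : ((n - 1 : ℕ) : ℝ≥0) + 1 = n := by
      have : n - 1 + 1 = n := by omega
      exact_mod_cast this
    rw [kept_congr S tgt hxy n hn, fresh_congr S hxy (n - 1) (by rw [e]; exact hn)]

end Peri

/-- The Peri-like strategy: for one target after the other, in each round keep the peer that was
the first to deliver a new message of the target and replace the other peers by nodes drawn from
the oracle; finally, connect to the nodes that were found. -/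
def peri {P : NetParams} (S : PeriSchedule P) (V : Type*) {L : Type*} {r : ℕ}
    (tgt : Fin r → L) : Strategy P V L r where
  queries := Peri.queryTimes S
  requests x t := Peri.roundRequests S tgt x ⌊t / S.len⌋₊
  horizon := (r * S.rounds + 1) * S.len
  output x := Peri.found S tgt x
  queries_spaced := by
    rintro s ⟨n, j, hj, rfl⟩ t ⟨n', j', hj', rfl⟩ hst
    rcases lt_trichotomy n n' with h | h | h
    · refine (Peri.query_end_le S n j hj).trans (le_trans ?_ le_self_add)
      gcongr
      exact_mod_cast h
    · subst h
      have h1 : (j : ℝ≥0) * P.tau < j' * P.tau := lt_of_add_lt_add_left hst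
      have h2 : j < j' := by exact_mod_cast lt_of_mul_lt_mul_right h1 (by simp)
      have h3 : ((j + 1 : ℕ) : ℝ≥0) * P.tau ≤ j' * P.tau := by
        gcongr
        exact h2
      calc (n : ℝ≥0) * S.len + j * P.tau + P.tau
          = n * S.len + ((j + 1 : ℕ) : ℝ≥0) * P.tau := by push_cast; ring
        _ ≤ _ := by gcongr
    · exfalso
      have h1 := Peri.query_end_le S n' j' hj'
      have h2 : ((n' : ℝ≥0) + 1) * S.len ≤ n * S.len := by
        gcongr
        exact_mod_cast h
      have h3 : (n' : ℝ≥0) * S.len + j' * P.tau ≤ n * S.len + j * P.tau :=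
        (le_self_add.trans h1).trans (h2.trans le_self_add)
      exact absurd hst (not_lt.2 h3)
  budget x t := Peri.card_roundRequests S tgt x _
  requests_causal x y t hxy := by
    refine Peri.roundRequests_congr S tgt hxy _ ?_
    have h : (⌊t / S.len⌋₊ : ℝ≥0) ≤ t / S.len := Nat.floor_le (by simp)
    calc (⌊t / S.len⌋₊ : ℝ≥0) * S.len ≤ t / S.len * S.len := by gcongr
      _ = t := div_mul_cancel₀ t S.len_pos.ne'
  output_causal x y hxy := by
    funext i
    refine Peri.found_congr S tgt hxy ?_ i
    push_cast
    gcongr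
    exact le_self_add

/-- The strategy `σ` fails on the sample path `ω`: at its horizon, some target is announced
wrongly, or the budget allows for being connected to all of the targets but some target is not
a peer of the agent. -/
def Strategy.FailsAt {P : NetParams} {V L Ω : Type*} {r : ℕ} (σ : Strategy P V L r)
    (N : NetworkData V L Ω) (tgt : Fin r → L) (ω : Ω) : Prop :=
  ¬ ((∀ i, σ.output (N.view ω) i = some (N.NID (tgt i))) ∧
    (r ≤ P.k → ∀ i, N.NID (tgt i) ∈ N.peers σ.horizon ω))

end

/-!
A target is the sender of its own messages, so by the triangle inequality its direct copy reaches
the agent no later than any relayed copy. A message reaches every node along a path without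
repetitions, hence within `maxNodes * maxLatency`; after a warm-up of that length, every message
that the agent receives was sent late enough for the direct copy to win. Thus a target that is a
peer at the time of its message delivers that message first, and once drawn from the oracle it is
kept for all further rounds.

What can go wrong is that the oracle never returns the target, that the target sends no message in
the listening window of some round, or that some requested slot stays blocked throughout the
warm-up. Each is exponentially unlikely. For the last one, the connections that occupy one slot do
not overlap, so at most `s + 1` of those established up to time `s` last longer than `1`; by
memorylessness, the expected number of those that last longer than `x` is smaller by a factor
`exp (-lam * (x - 1))`. With the number and the length of the rounds proportional to
`1 + log (r / ε)`, the union bound is at most `ε`, and the strategy takes time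
`O(r * (1 + log (r / ε)) ^ 2)`.
-/

/-! ### Flooding -/

theorem exists_biInf_eq_of_subsingleton {α β : Type*} [CompleteLattice β] {p : α → Prop}
    (hp : {t | p t}.Subsingleton) {f : α → β} (h : ⨅ (t) (_ : p t), f t ≠ ⊤) :
    ∃ t, p t ∧ ⨅ (t) (_ : p t), f t = f t := by
  obtain ⟨t, ht⟩ : ∃ t, p t := by
    by_contra! hempty
    exact h (by simp [hempty])
  exact ⟨t, ht, le_antisymm (iInf₂_le t ht) (le_iInf₂ fun s hs => (congrArg f (hp ht hs)).le)⟩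

namespace NetworkData

variable {V L Ω : Type*} (N : NetworkData V L Ω) (u : L) (m : ℕ) (ω : Ω)

/-- The nodes that receive a message strictly before a given node. Their number bounds the number
of hops of the copy that reaches the node first. -/
def earlier (v : V) : Set V :=
  {p | N.reception u m ω p < N.reception u m ω v}

theorem ncard_earlier_lt_ncard_earlier [Finite V] {p v : V}
    (h : N.reception u m ω p < N.reception u m ω v) :
    (N.earlier u m ω p).ncard < (N.earlier u m ω v).ncard :=
  Set.ncard_lt_ncard
    ⟨fun _ ha => lt_trans ha h, fun hsub => lt_irrefl (N.reception u m ω p) (hsub h)⟩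

theorem ncard_earlier_lt_card [Fintype V] (v : V) :
    (N.earlier u m ω v).ncard < Fintype.card V := by
  rw [← Nat.card_eq_fintype_card, ← Set.ncard_univ]
  exact Set.ncard_lt_ncard
    ⟨Set.subset_univ _, fun hsub => lt_irrefl (N.reception u m ω v) (hsub (Set.mem_univ v))⟩

theorem reception_add_le_deliveryTime (v : V) :
    N.reception u m ω v + N.w (some v) none ≤ N.deliveryTime u m ω v :=
  le_iInf₂ fun t ht => by rw [ht.1, ENNReal.coe_add]

theorem exists_deliveryTime_eq (h : N.firstArrival u m ω ≠ ⊤) :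
    ∃ v, N.reception u m ω v ≠ ⊤ ∧
      N.deliveryTime u m ω v = N.reception u m ω v + N.w (some v) none := by
  obtain ⟨v, hv⟩ : ∃ v, N.deliveryTime u m ω v ≠ ⊤ := by
    by_contra! htop
    exact h (by simp [firstArrival, htop])
  obtain ⟨t, ⟨ht, -⟩, hdel⟩ := exists_biInf_eq_of_subsingleton
    (fun s hs t ht => ENNReal.coe_injective (hs.1.symm.trans ht.1)) hv
  exact ⟨v, ht ▸ ENNReal.coe_ne_top, by rw [deliveryTime, hdel, ht, ENNReal.coe_add]⟩

end NetworkData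

namespace IsP2PNetwork

variable {P : NetParams} {V L Ω : Type*} [Fintype V] {N : NetworkData V L Ω}
  {u : L} {m : ℕ} {ω : Ω}

theorem exists_relay (hN : IsP2PNetwork P N) {v : V} (hv : v ≠ N.NID u)
    (hfin : N.reception u m ω v ≠ ⊤) :
    ∃ p, N.reception u m ω p < N.reception u m ω v ∧
      N.reception u m ω v = N.reception u m ω p + N.w (some p) (some v) := by
  have : Nonempty V := ⟨v⟩
  have hflood := hN.reception_flood u m ω v hv
  obtain ⟨p, hp⟩ := exists_eq_ciInf_of_finite (f := fun p : V =>
    ⨅ (t : ℝ≥0) (_ : N.reception u m ω p = t ∧ (N.graph t ω).Adj p v),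
      ((t + N.w (some p) (some v) : ℝ≥0) : ℝ≥0∞))
  rw [← hp] at hflood
  obtain ⟨t, ⟨ht, hadj⟩, hinf⟩ := exists_biInf_eq_of_subsingleton
    (fun s hs t ht => ENNReal.coe_injective (hs.1.symm.trans ht.1)) (hflood ▸ hfin)
  rw [hinf] at hflood
  refine ⟨p, ?_, by rw [hflood, ht, ENNReal.coe_add]⟩
  rw [hflood, ht]
  exact_mod_cast lt_add_of_pos_right t (hN.w_pos _ _ (by simpa using hadj.ne))

@[elab_as_elim]
theorem reception_induction (hN : IsP2PNetwork P N)
    {motive : ∀ v, N.reception u m ω v ≠ ⊤ → Prop}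
    (source : ∀ hfin, motive (N.NID u) hfin)
    (relay : ∀ p v hfin, (hlt : N.reception u m ω p < N.reception u m ω v) →
      N.reception u m ω v = N.reception u m ω p + N.w (some p) (some v) →
      motive p hlt.ne_top → motive v hfin)
    (v : V) (hfin : N.reception u m ω v ≠ ⊤) : motive v hfin := by
  induction hk : (N.earlier u m ω v).ncard using Nat.strong_induction_on generalizing v with
  | _ k ih =>
    by_cases hv : v = N.NID u
    · subst hv
      exact source hfin
    obtain ⟨p, hlt, hp⟩ := hN.exists_relay hv hfin
    have hcard := N.ncard_earlier_lt_ncard_earlier u m ω hlt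
    exact relay p v hfin hlt hp (ih _ (hk ▸ hcard) p hlt.ne_top rfl)

theorem broadcastTime_add_le_reception_add (hN : IsP2PNetwork P N) (v : V) (y : Option V) :
    N.broadcastTime u m ω + N.w (some (N.NID u)) y ≤ N.reception u m ω v + N.w (some v) y := by
  by_cases hfin : N.reception u m ω v = ⊤
  · simp [hfin]
  induction v, hfin using hN.reception_induction generalizing y with
  | source => rw [hN.reception_source]
  | relay p v _ _ hp ih =>
    calc N.broadcastTime u m ω + N.w (some (N.NID u)) y
        ≤ N.reception u m ω p + N.w (some p) y := ih y
      _ ≤ N.reception u m ω p + (N.w (some p) (some v) + N.w (some v) y) := by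
          gcongr
          exact_mod_cast hN.triangle _ _ _
      _ = N.reception u m ω v + N.w (some v) y := by rw [hp, add_assoc]

theorem reception_le (hN : IsP2PNetwork P N) (v : V) (hfin : N.reception u m ω v ≠ ⊤) :
    N.reception u m ω v ≤
      N.broadcastTime u m ω + (N.earlier u m ω v).ncard * P.maxLatency := by
  induction v, hfin using hN.reception_induction with
  | source => exact (hN.reception_source u m ω).trans_le le_self_add
  | relay p v _ hlt hp ih =>
    have hcard : (N.earlier u m ω p).ncard + 1 ≤ (N.earlier u m ω v).ncard :=
      N.ncard_earlier_lt_ncard_earlier u m ω hlt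
    calc N.reception u m ω v
        ≤ N.broadcastTime u m ω + (N.earlier u m ω p).ncard * P.maxLatency + P.maxLatency := by
          rw [hp]
          gcongr
          exact hN.w_le _ _
      _ = N.broadcastTime u m ω +
            ((N.earlier u m ω p).ncard + 1 : ℕ) * P.maxLatency := by push_cast; ring
      _ ≤ _ := by gcongr

theorem broadcastTime_add_le_firstArrival (hN : IsP2PNetwork P N) :
    N.broadcastTime u m ω + N.w (some (N.NID u)) none ≤ N.firstArrival u m ω :=
  le_iInf fun v => (hN.broadcastTime_add_le_reception_add v none).trans
    (N.reception_add_le_deliveryTime u m ω v)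

theorem broadcastTime_le_firstArrival (hN : IsP2PNetwork P N) :
    N.broadcastTime u m ω ≤ N.firstArrival u m ω :=
  le_self_add.trans hN.broadcastTime_add_le_firstArrival

theorem firstArrival_le (hN : IsP2PNetwork P N) (hfin : N.firstArrival u m ω ≠ ⊤) :
    N.firstArrival u m ω ≤ N.broadcastTime u m ω + P.maxNodes * P.maxLatency := by
  obtain ⟨v, hv, hdel⟩ := N.exists_deliveryTime_eq u m ω hfin
  have hcard : (N.earlier u m ω v).ncard + 1 ≤ P.maxNodes :=
    (N.ncard_earlier_lt_card u m ω v).trans_le hN.card_le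
  calc N.firstArrival u m ω ≤ N.reception u m ω v + N.w (some v) none := hdel ▸ iInf_le _ v
    _ ≤ N.broadcastTime u m ω + (N.earlier u m ω v).ncard * P.maxLatency + P.maxLatency := by
        gcongr
        exacts [hN.reception_le v hv, hN.w_le _ _]
    _ = N.broadcastTime u m ω + ((N.earlier u m ω v).ncard + 1 : ℕ) * P.maxLatency := by
        push_cast; ring
    _ ≤ _ := by gcongr

theorem firstArrival_and_firstPeer_of_mem_peers (hN : IsP2PNetwork P N) {t : ℝ≥0}
    (ht : N.broadcastTime u m ω = t) (hpeer : N.NID u ∈ N.peers t ω) :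
    N.firstArrival u m ω = t + N.w (some (N.NID u)) none ∧
      N.firstPeer u m ω = some (N.NID u) := by
  have hlower := hN.broadcastTime_add_le_firstArrival (u := u) (m := m) (ω := ω)
  have hdirect : N.deliveryTime u m ω (N.NID u) ≤ t + N.w (some (N.NID u)) none := by
    rw [← ENNReal.coe_add]
    exact iInf₂_le t ⟨by rw [hN.reception_source, ht], hpeer⟩
  have hmin : N.firstArrival u m ω ≤ N.deliveryTime u m ω (N.NID u) := iInf_le _ _
  rw [ht] at hlower
  have harrival := le_antisymm (hmin.trans hdirect) hlower
  refine ⟨harrival, hN.firstPeer_direct u m ω ?_ (le_antisymm (hdirect.trans hlower) hmin)⟩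
  rw [harrival]
  exact ENNReal.add_ne_top.2 ⟨ENNReal.coe_ne_top, ENNReal.coe_ne_top⟩

theorem lt_M_of_broadcastTime_lt (hN : IsP2PNetwork P N) {b : ℝ≥0}
    (h : N.broadcastTime u m ω < b) : m < N.M u b ω := by
  simp only [NetworkData.broadcastTime, iInf_lt_iff] at h
  obtain ⟨t, ht, htb⟩ := h
  exact ht.trans_le (hN.M_mono u ω (by exact_mod_cast htb.le))

theorem le_broadcastTime (hN : IsP2PNetwork P N) {a : ℝ≥0} (h : N.M u a ω ≤ m) :
    a ≤ N.broadcastTime u m ω := by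
  by_contra! hlt
  exact (hN.lt_M_of_broadcastTime_lt hlt).not_ge h

/-- Every copy of a message arrives at most `maxNodes * maxLatency` after the broadcast, so a
message that arrives this long after `a` was broadcast while the agent was a peer of its sender. -/
theorem firstPeer_eq_of_mem_peers (hN : IsP2PNetwork P N) {a b : ℝ≥0}
    (hpeer : ∀ t ∈ Set.Ico a b, N.NID u ∈ N.peers t ω)
    (hm : N.firstArrival u m ω ∈ Set.Ico (a + P.maxNodes * P.maxLatency : ℝ≥0∞) b) :
    N.firstPeer u m ω = some (N.NID u) := by
  have hlt : N.broadcastTime u m ω < b := hN.broadcastTime_le_firstArrival.trans_lt hm.2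
  have hle : a ≤ N.broadcastTime u m ω := by
    have h := hm.1.trans (hN.firstArrival_le (hm.2.trans ENNReal.coe_lt_top).ne)
    exact (ENNReal.add_le_add_iff_right (by finiteness)).1 h
  lift N.broadcastTime u m ω to ℝ≥0 using hlt.ne_top with t ht
  exact (hN.firstArrival_and_firstPeer_of_mem_peers ht.symm
    (hpeer t ⟨by exact_mod_cast hle, by exact_mod_cast hlt⟩)).2

theorem exists_firstArrival_mem_Ico (hN : IsP2PNetwork P N) {a b x : ℝ≥0}
    (hb : a + x + P.maxLatency < b) (hpeer : ∀ t ∈ Set.Ico a b, N.NID u ∈ N.peers t ω)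
    (hmsg : N.M u a ω < N.M u (a + x) ω) :
    ∃ m, N.firstArrival u m ω ∈ Set.Ico (a : ℝ≥0∞) b := by
  refine ⟨N.M u a ω, ?_⟩
  have hle : (a : ℝ≥0∞) ≤ N.broadcastTime u (N.M u a ω) ω := hN.le_broadcastTime le_rfl
  have hge : N.broadcastTime u (N.M u a ω) ω ≤ (a + x : ℝ≥0) := iInf₂_le (a + x) hmsg
  refine ⟨hle.trans hN.broadcastTime_le_firstArrival, ?_⟩
  lift N.broadcastTime u (N.M u a ω) ω to ℝ≥0 using (hge.trans_lt ENNReal.coe_lt_top).ne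
    with t ht
  rw [ENNReal.coe_le_coe] at hle hge
  have htb : t < b := (hge.trans le_self_add).trans_lt hb
  rw [(hN.firstArrival_and_firstPeer_of_mem_peers ht.symm (hpeer t ⟨hle, htb⟩)).1]
  exact_mod_cast (add_le_add hge (hN.w_le _ _)).trans_lt hb

theorem finite_setOf_firstArrival_lt (hN : IsP2PNetwork P N) (b : ℝ≥0) :
    {m | N.firstArrival u m ω < b}.Finite :=
  (Set.finite_Iio (N.M u b ω)).subset fun _ hm =>
    hN.lt_M_of_broadcastTime_lt (hN.broadcastTime_le_firstArrival.trans_lt hm)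

theorem exists_firstIn (hN : IsP2PNetwork P N) {a b : ℝ≥0}
    (h : ∃ m, N.firstArrival u m ω ∈ Set.Ico (a : ℝ≥0∞) b) :
    ∃ m, Peri.FirstIn (N.view ω) u a b m :=
  Set.exists_min_image {m | N.firstArrival u m ω ∈ Set.Ico (a : ℝ≥0∞) b}
    (fun m => N.firstArrival u m ω)
    ((hN.finite_setOf_firstArrival_lt b).subset fun _ hm => hm.2) h

end IsP2PNetwork

/-! ### Probabilities of the obstructions -/

theorem sum_indicator_le_of_add_one_le {a : ℕ → ℝ≥0∞} (ha : Monotone a) {s : ℝ≥0∞} {I : Set ℕ}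
    (hI : ∀ n ∈ I, a n ≤ s ∧ a n + 1 ≤ a (n + 1)) (n : ℕ) :
    ∑ m ∈ Finset.range n, I.indicator (1 : ℕ → ℝ≥0∞) m ≤ min (a n) (s + 1) := by
  induction n with
  | zero => simp
  | succ n ih =>
    obtain ⟨ih_a, ih_s⟩ := le_min_iff.1 ih
    rw [Finset.sum_range_succ]
    by_cases hn : n ∈ I
    · obtain ⟨hs, hgap⟩ := hI n hn
      rw [Set.indicator_of_mem hn, Pi.one_apply]
      exact le_min ((by gcongr : _ ≤ a n + 1).trans hgap) (by gcongr; exact ih_a.trans hs)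
    · rw [Set.indicator_of_notMem hn, add_zero]
      exact le_min (ih_a.trans (ha n.le_succ)) ih_s

theorem tsum_indicator_le_of_add_one_le {a : ℕ → ℝ≥0∞} (ha : Monotone a) {s : ℝ≥0∞} {I : Set ℕ}
    (hI : ∀ n ∈ I, a n ≤ s ∧ a n + 1 ≤ a (n + 1)) :
    ∑' n, I.indicator (1 : ℕ → ℝ≥0∞) n ≤ s + 1 :=
  ENNReal.tsum_le_of_sum_range_le fun n =>
    (sum_indicator_le_of_add_one_le ha hI n).trans (min_le_right _ _)

theorem expMeasure_Ioi {r x : ℝ} (hr : 0 < r) (hx : 0 ≤ x) :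
    expMeasure r (Set.Ioi x) = ENNReal.ofReal (Real.exp (-(r * x))) := by
  have := isProbabilityMeasure_expMeasure hr
  rw [← Set.compl_Iic, prob_compl_eq_one_sub measurableSet_Iic, ← ofReal_cdf,
    cdf_expMeasure_eq hr, if_pos hx, ← ENNReal.ofReal_one,
    ← ENNReal.ofReal_sub _ (by simpa using mul_nonneg hr.le hx), sub_sub_cancel]

theorem IsPoissonProcess.measureReal_no_arrival {Ω : Type*} [MeasurableSpace Ω] {μ : Measure Ω}
    {nu : ℝ≥0} {M : ℝ≥0 → Ω → ℕ} (hM : IsPoissonProcess nu M μ) (a x : ℝ≥0) :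
    μ.real {ω | M (a + x) ω ≤ M a ω} = Real.exp (-(nu * x)) := by
  calc μ.real {ω | M (a + x) ω ≤ M a ω}
      = μ.real ((fun ω => M (a + x) ω - M a ω) ⁻¹' {0}) := by
        congr 1
        ext ω
        exact Nat.sub_eq_zero_iff_le.symm
    _ = (poissonMeasure (nu * (a + x - a))).real {0} :=
        (hM.law a (a + x) le_self_add).measureReal_eq (measurableSet_singleton 0)
    _ = Real.exp (-(nu * x)) := by simp [poissonMeasure_real_singleton]

namespace NetworkData

variable {V L Ω : Type*} (N : NetworkData V L Ω)

/-- The event that the `n`-th connection in the slot `i` of `v` is established by time `s`, and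
not with the agent. -/
def establishedBy (v : V) (i : Fin (N.slots v)) (s : ℝ≥0) (n : ℕ) : Set Ω :=
  {ω | N.start v i n ω ≤ s ∧ (N.occupant v i n ω).isNone = false}

/-- The event that a connection in the slot `i` of `v` established by time `s`, and not with the
agent, lasts longer than `x`. Outside this event the slot becomes free by time `s + x`, because
connections established before `s` have been running for some time already. -/
def blocked (v : V) (i : Fin (N.slots v)) (s x : ℝ≥0) : Set Ω :=
  ⋃ n, N.establishedBy v i s n ∩ {ω | (x : ℝ) < N.lifetime v i n ω}

/-- The event that `u` sends no message during `(a, a + x]`. -/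
def silent (u : L) (a x : ℝ≥0) : Set Ω :=
  {ω | N.M u (a + x) ω ≤ N.M u a ω}

/-- The event that the oracle never answers `v` to the first `n` of the queries submitted at the
times `s 0, s 1, …`. -/
def missed (v : V) (s : ℕ → ℝ≥0) (n : ℕ) : Set Ω :=
  {ω | ∀ m < n, N.oracle (s m) ω ≠ v}

theorem missed_succ (v : V) (s : ℕ → ℝ≥0) (n : ℕ) :
    N.missed v s (n + 1) = N.missed v s n \ {ω | N.oracle (s n) ω = v} := by
  ext ω
  exact Nat.forall_lt_succ_right

theorem measurableSet_oracleHistory_missed {P : NetParams} {s : ℕ → ℝ≥0}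
    (hs : ∀ n, s n + P.tau ≤ s (n + 1)) (v : V) (n : ℕ) :
    MeasurableSet[N.oracleHistory P (s n)] (N.missed v s n) := by
  have hmono : Monotone s := monotone_nat_of_le_succ fun n => le_self_add.trans (hs n)
  have hinter : N.missed v s n = ⋂ (m : ℕ) (_ : m < n), N.oracle (s m) ⁻¹' {v}ᶜ := by
    ext ω
    simp [missed]
  rw [hinter]
  refine MeasurableSet.iInter fun m => MeasurableSet.iInter fun hm => ?_
  have hle : MeasurableSpace.comap (N.oracle (s m)) ⊤ ≤ N.oracleHistory P (s n) :=
    le_iSup₂_of_le (s m) ((hs m).trans (hmono hm)) le_rfl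
  exact hle _ ⟨{v}ᶜ, trivial, rfl⟩

end NetworkData

namespace IsP2PNetwork

variable {P : NetParams} {V L Ω : Type*} [Fintype V] {N : NetworkData V L Ω}

theorem monotone_start (hN : IsP2PNetwork P N) (v : V) (i : Fin (N.slots v)) (ω : Ω) :
    Monotone fun n => N.start v i n ω :=
  monotone_nat_of_le_succ fun n =>
    (hN.start_le_finish v i n ω).trans (hN.finish_le_start v i n ω)

theorem finish_eq_of_mem_establishedBy (hN : IsP2PNetwork P N) {v : V} {i : Fin (N.slots v)}
    {s : ℝ≥0} {n : ℕ} {ω : Ω} (h : ω ∈ N.establishedBy v i s n) :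
    N.finish v i n ω = N.start v i n ω + ENNReal.ofReal (N.lifetime v i n ω) := by
  obtain ⟨y, hy⟩ := Option.isSome_iff_exists.1 (Option.isNone_eq_false_iff.1 h.2)
  exact hN.finish_eq v i n ω y hy

theorem tsum_indicator_establishedBy_le (hN : IsP2PNetwork P N) (v : V) (i : Fin (N.slots v))
    (s : ℝ≥0) (ω : Ω) :
    ∑' n, (N.establishedBy v i s n ∩ {ω | 1 < N.lifetime v i n ω}).indicator
      (1 : Ω → ℝ≥0∞) ω ≤ s + 1 := by
  refine tsum_indicator_le_of_add_one_le (hN.monotone_start v i ω)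
    (I := {n | ω ∈ N.establishedBy v i s n ∩ {ω | 1 < N.lifetime v i n ω}})
    fun n ⟨hest, hlong⟩ => ⟨hest.1, ?_⟩
  calc N.start v i n ω + 1
      ≤ N.start v i n ω + ENNReal.ofReal (N.lifetime v i n ω) := by
        gcongr
        exact ENNReal.one_le_ofReal.2 (le_of_lt hlong)
    _ = N.finish v i n ω := (hN.finish_eq_of_mem_establishedBy hest).symm
    _ ≤ N.start v i (n + 1) ω := hN.finish_le_start v i n ω

theorem mem_peers_of_requests (hN : IsP2PNetwork P N) {v : V} {i : Fin (N.slots v)}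
    {s x t : ℝ≥0} {ω : Ω} (hfree : ω ∉ N.blocked v i s x) (hv : v ∈ N.nodes s ω)
    (ht : s + x ≤ t) (hreq : ∀ t' ∈ Set.Icc s t, v ∈ N.requests t' ω) : v ∈ N.peers t ω := by
  by_contra hnot
  obtain ⟨n, hstart, hfinish, hocc⟩ := hN.fcfs v s t ω (le_self_add.trans ht) hv hreq hnot i
  have hest : ω ∈ N.establishedBy v i s n :=
    ⟨hstart, Option.isNone_eq_false_iff.2 (Option.isSome_iff_ne_none.2 hocc)⟩
  have hshort : N.lifetime v i n ω ≤ x :=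
    not_lt.1 fun hlong => hfree (Set.mem_iUnion.2 ⟨n, hest, hlong⟩)
  refine hfinish.not_ge ?_
  calc N.finish v i n ω
      = N.start v i n ω + ENNReal.ofReal (N.lifetime v i n ω) :=
        hN.finish_eq_of_mem_establishedBy hest
    _ ≤ s + x := by
        gcongr
        exact ENNReal.ofReal_le_of_le_toReal hshort
    _ ≤ t := by exact_mod_cast ht

end IsP2PNetwork

namespace IsLive

variable {lam : ℝ} {nu : ℝ≥0} {V L Ω : Type*} [MeasurableSpace Ω] {N : NetworkData V L Ω}
  {T : Set L} {μ : Measure Ω}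

theorem measurableSet_establishedBy (hL : IsLive lam nu N T μ) (v : V) (i : Fin (N.slots v))
    (s : ℝ≥0) (n : ℕ) : MeasurableSet (N.establishedBy v i s n) :=
  (measurableSet_le (hL.measurable_start v i n) measurable_const).inter
    (hL.measurable_occupant v i n (measurableSet_singleton false))

theorem measure_establishedBy_inter (hL : IsLive lam nu N T μ) (hlam : 0 < lam) (v : V)
    (i : Fin (N.slots v)) (s : ℝ≥0) (n : ℕ) {x : ℝ} (hx : 0 ≤ x) :
    μ (N.establishedBy v i s n ∩ {ω | x < N.lifetime v i n ω}) =
      μ (N.establishedBy v i s n) * ENNReal.ofReal (Real.exp (-(lam * x))) := by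
  have hlife : μ (N.lifetime v i n ⁻¹' Set.Ioi x) = expMeasure lam (Set.Ioi x) :=
    (hL.lifetime_law v i n).measure_eq measurableSet_Ioi
  have hindep := (hL.lifetime_indep v i n).symm.measure_inter_preimage_eq_mul
    (Set.Iic (s : ℝ≥0∞) ×ˢ {false}) (Set.Ioi x)
    (measurableSet_Iic.prod (measurableSet_singleton _)) measurableSet_Ioi
  rwa [hlife, expMeasure_Ioi hlam hx] at hindep

/-- The infinitely many connections of a slot are controlled by comparing those that last longer
than `x` with those that last longer than `1`, of which at most `s + 1` begin by time `s`. -/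
theorem measure_blocked_le {P : NetParams} [Fintype V] [IsProbabilityMeasure μ]
    (hL : IsLive lam nu N T μ) (hlam : 0 < lam) (hN : IsP2PNetwork P N) (v : V)
    (i : Fin (N.slots v)) (s x : ℝ≥0) :
    μ (N.blocked v i s x) ≤ ENNReal.ofReal (Real.exp (lam * (1 - x))) * (s + 1) := by
  set A : ℕ → Set Ω := fun n => N.establishedBy v i s n ∩ {ω | 1 < N.lifetime v i n ω} with hA
  have hmeas (n : ℕ) : NullMeasurableSet (A n) μ :=
    (hL.measurableSet_establishedBy v i s n).nullMeasurableSet.inter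
      ((hL.lifetime_law v i n).aemeasurable.nullMeasurable measurableSet_Ioi)
  have hlong : ∑' n, μ (A n) ≤ s + 1 :=
    calc ∑' n, μ (A n) = ∑' n, ∫⁻ ω, (A n).indicator 1 ω ∂μ :=
          tsum_congr fun n => (lintegral_indicator_one₀ (hmeas n)).symm
      _ = ∫⁻ ω, ∑' n, (A n).indicator 1 ω ∂μ :=
          (lintegral_tsum fun n => aemeasurable_one.indicator₀ (hmeas n)).symm
      _ ≤ ∫⁻ _, (s + 1 : ℝ≥0∞) ∂μ :=
          lintegral_mono fun ω => hN.tsum_indicator_establishedBy_le v i s ω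
      _ = s + 1 := by simp
  have hmemoryless (n : ℕ) : μ (N.establishedBy v i s n ∩ {ω | (x : ℝ) < N.lifetime v i n ω}) =
      ENNReal.ofReal (Real.exp (lam * (1 - x))) * μ (A n) := by
    have hexp : Real.exp (-(lam * x)) = Real.exp (-(lam * 1)) * Real.exp (lam * (1 - x)) := by
      rw [← Real.exp_add]
      ring_nf
    rw [hL.measure_establishedBy_inter hlam v i s n x.coe_nonneg, hA,
      hL.measure_establishedBy_inter hlam v i s n zero_le_one, hexp,
      ENNReal.ofReal_mul (Real.exp_nonneg _)]
    ring
  calc μ (N.blocked v i s x)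
      ≤ ∑' n, μ (N.establishedBy v i s n ∩ {ω | (x : ℝ) < N.lifetime v i n ω}) :=
        measure_iUnion_le _
    _ = ENNReal.ofReal (Real.exp (lam * (1 - x))) * ∑' n, μ (A n) := by
        rw [← ENNReal.tsum_mul_left]
        exact tsum_congr hmemoryless
    _ ≤ _ := by gcongr

theorem measureReal_blocked_le {P : NetParams} [Fintype V] [IsProbabilityMeasure μ]
    (hL : IsLive lam nu N T μ) (hlam : 0 < lam) (hN : IsP2PNetwork P N) (v : V)
    (i : Fin (N.slots v)) (s x : ℝ≥0) :
    μ.real (N.blocked v i s x) ≤ Real.exp (lam * (1 - x)) * (s + 1) := by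
  refine ENNReal.toReal_le_of_le_ofReal (by positivity) ?_
  rw [ENNReal.ofReal_mul (Real.exp_nonneg _), ← NNReal.coe_one, ← NNReal.coe_add,
    ENNReal.ofReal_coe_nnreal]
  exact_mod_cast hL.measure_blocked_le hlam hN v i s x

theorem measureReal_silent (hL : IsLive lam nu N T μ) {u : L} (hu : u ∈ T) (a x : ℝ≥0) :
    μ.real (N.silent u a x) = Real.exp (-(nu * x)) :=
  (hL.poisson u hu).measureReal_no_arrival a x

end IsLive

namespace HasOracleLaw

variable {P : NetParams} {V L Ω : Type*} [MeasurableSpace Ω] {N : NetworkData V L Ω}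
  {μ : Measure Ω}

theorem measureReal_sdiff_le [IsFiniteMeasure μ] (hO : HasOracleLaw P N μ) {s : ℝ≥0} {v : V}
    (hv : ∀ ω, v ∈ N.nodes s ω) {A : Set Ω} (hA : MeasurableSet[N.oracleHistory P s] A) :
    μ.real (A \ {ω | N.oracle s ω = v}) ≤ (1 - P.q) * μ.real A := by
  have hdraw := ENNReal.toReal_mono (by finiteness) (hO.le_draw s v A hA)
  have huniv : {ω | v ∈ N.nodes s ω} = Set.univ := Set.eq_univ_of_forall hv
  rw [huniv, Set.inter_univ, ENNReal.toReal_mul, ENNReal.coe_toReal] at hdraw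
  have hsplit := measureReal_inter_add_sdiff (μ := μ) (s := A) (hO.measurable s v)
  simp only [Measure.real] at hsplit ⊢
  linarith

theorem measureReal_missed_le [IsProbabilityMeasure μ] (hO : HasOracleLaw P N μ) {v : V}
    (hv : ∀ s ω, v ∈ N.nodes s ω) {s : ℕ → ℝ≥0} (hs : ∀ n, s n + P.tau ≤ s (n + 1)) (n : ℕ) :
    μ.real (N.missed v s n) ≤ Real.exp (-(P.q * n)) := by
  induction n with
  | zero => simp
  | succ n ih =>
    calc μ.real (N.missed v s (n + 1))
        ≤ (1 - P.q) * μ.real (N.missed v s n) := by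
          rw [N.missed_succ]
          exact hO.measureReal_sdiff_le (hv _) (N.measurableSet_oracleHistory_missed hs v n)
      _ ≤ Real.exp (-P.q) * Real.exp (-(P.q * n)) := by
          gcongr
          exact Real.one_sub_le_exp_neg _
      _ = Real.exp (-(P.q * (n + 1 : ℕ))) := by
          rw [← Real.exp_add]
          push_cast
          ring_nf

end HasOracleLaw

/-! ### Peri rounds -/

/-- The rounds of the schedule leave a time `x` for getting a slot, before the waiting time that
it takes until all copies of the earlier messages have arrived is over, and another time `x` for
a message to be sent afterwards, which still reaches the agent within the round. -/
structure PeriSchedule.Accommodates {P : NetParams} (S : PeriSchedule P) (x : ℝ≥0) : Prop where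
  add_le_warm : x + P.maxNodes * P.maxLatency ≤ S.warm
  add_lt_len : S.warm + x + P.maxLatency < S.len

namespace PeriSchedule

variable {P : NetParams} {S : PeriSchedule P} {x : ℝ≥0}

theorem tau_le_len (S : PeriSchedule P) : P.tau ≤ S.len := by
  have hk : 1 ≤ P.k - 1 := Nat.le_sub_of_add_le P.two_le_k
  exact (le_mul_of_one_le_left' (by exact_mod_cast hk)).trans S.queries_le

theorem Accommodates.le_warm (hS : S.Accommodates x) : x ≤ S.warm :=
  le_self_add.trans hS.add_le_warm

theorem Accommodates.le_len (hS : S.Accommodates x) : x ≤ S.len :=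
  le_trans (by rw [add_right_comm]; exact le_add_self) hS.add_lt_len.le

end PeriSchedule

namespace Peri

variable {P : NetParams} {V L Ω : Type*} {r : ℕ} {S : PeriSchedule P} {tgt : Fin r → L}

theorem heard_eq_some {y : AgentView V L} {u : L} {a b : ℝ≥0} {v : V}
    (hfirst : ∀ m, y.arrival u m ∈ Set.Ico (a : ℝ≥0∞) b → y.firstPeer u m = some v)
    (hex : ∃ m, FirstIn y u a b m) : heard y u a b = some v := by
  rw [heard, dif_pos hex]
  exact hfirst _ hex.choose_spec.1

theorem heard_eq_none_or_eq_some {y : AgentView V L} {u : L} {a b : ℝ≥0} {v : V}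
    (hfirst : ∀ m, y.arrival u m ∈ Set.Ico (a : ℝ≥0∞) b → y.firstPeer u m = some v) :
    heard y u a b = none ∨ heard y u a b = some v := by
  by_cases hex : ∃ m, FirstIn y u a b m
  · exact Or.inr (heard_eq_some hfirst hex)
  · exact Or.inl (dif_neg hex)

theorem kept_succ {n : ℕ} {i : Fin r} (hn : n ∈ Set.Ico (i * S.rounds) ((i + 1) * S.rounds))
    (y : AgentView V L) :
    kept S tgt y (n + 1) = (heard y (tgt i) (n * S.len + S.warm) ((n + 1) * S.len)).or
      (kept S tgt y n) := by
  have hdiv : n / S.rounds = i := Nat.div_eq_of_lt_le hn.1 hn.2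
  have hfin : (⟨n / S.rounds, hdiv ▸ i.2⟩ : Fin r) = i := Fin.ext hdiv
  rw [kept, dif_pos (hdiv ▸ i.2), hfin]

theorem mem_roundRequests_of_kept {y : AgentView V L} {n : ℕ} {v : V} (hn : n < r * S.rounds)
    (hk : kept S tgt y n = some v) : v ∈ roundRequests S tgt y n := by
  classical
  have hn0 : n ≠ 0 := by
    rintro rfl
    simp [kept] at hk
  rw [roundRequests, if_neg hn.not_ge, if_neg hn0, hk]
  exact Finset.mem_union_left _ (by simp)

theorem mem_roundRequests_of_answer {y : AgentView V L} {n : ℕ} {v : V}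
    (hn : n + 1 < r * S.rounds) (hv : y.answer (n * S.len) = v) :
    v ∈ roundRequests S tgt y (n + 1) := by
  classical
  have hk : 0 < P.k - 1 := Nat.sub_pos_of_lt P.two_le_k
  rw [roundRequests, if_neg hn.not_ge, if_neg n.succ_ne_zero]
  exact Finset.mem_union_right _
    (Finset.mem_image.2 ⟨0, Finset.mem_range.2 hk, by simpa using hv⟩)

theorem mem_finalRequests {y : AgentView V L} {v : Fin r → V}
    (hfound : ∀ i, found S tgt y i = some (v i)) (hr : r ≤ P.k) (i : Fin r) :
    v i ∈ finalRequests S tgt y := by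
  classical
  have hcard : (Finset.univ.biUnion fun i => (found S tgt y i).toFinset).card ≤ P.k :=
    calc _ ≤ ∑ i, (found S tgt y i).toFinset.card := Finset.card_biUnion_le
      _ = r := by simp [hfound]
      _ ≤ P.k := hr
  rw [finalRequests, if_pos hcard]
  exact Finset.mem_biUnion.2 ⟨i, Finset.mem_univ _, by simp [hfound]⟩

variable {N : NetworkData V L Ω} {x : ℝ≥0} {ω : Ω}

theorem requests_eq_roundRequests (hF : (peri S V tgt).Follows N) {n : ℕ} {t : ℝ≥0}
    (ht : t ∈ Set.Ico (n * S.len) ((n + 1) * S.len)) (ω : Ω) :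
    N.requests t ω = roundRequests S tgt (N.view ω) n := by
  have hfloor : ⌊t / S.len⌋₊ = n := (Nat.floor_eq_iff zero_le).2
    ⟨(le_div_iff₀ S.len_pos).2 ht.1, (div_lt_iff₀ S.len_pos).2 ht.2⟩
  rw [hF t ω, ← hfloor]
  rfl

theorem requests_eq_finalRequests (hF : (peri S V tgt).Follows N) {t : ℝ≥0}
    (ht : (r * S.rounds : ℕ) * S.len ≤ t) (ω : Ω) :
    N.requests t ω = finalRequests S tgt (N.view ω) := by
  have hfloor : r * S.rounds ≤ ⌊t / S.len⌋₊ := Nat.le_floor ((le_div_iff₀ S.len_pos).2 ht)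
  exact (hF t ω).trans (if_pos hfloor)

/-- The event that the search for the target `i` meets with an obstruction: the oracle misses its
node at the beginning of all rounds devoted to it but the last, or in some round the target is
silent, or in some round (including the final one) the slot `j` of its node stays blocked. -/
def obstructed (S : PeriSchedule P) (tgt : Fin r → L) (N : NetworkData V L Ω) (x : ℝ≥0)
    (i : Fin r) (j : Fin (N.slots (N.NID (tgt i)))) : Set Ω :=
  N.missed (N.NID (tgt i)) (fun m => (i * S.rounds + m : ℕ) * S.len) (S.rounds - 1) ∪
    (⋃ n ∈ Finset.range (r * S.rounds), N.silent (tgt i) (n * S.len + S.warm) x) ∪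
    ⋃ n ∈ Finset.range (r * S.rounds + 1), N.blocked (N.NID (tgt i)) j (n * S.len) x

variable [Fintype V]

theorem mem_peers_of_mem_roundRequests (hN : IsP2PNetwork P N) (hF : (peri S V tgt).Follows N)
    {v : V} {j : Fin (N.slots v)} {n : ℕ} (hv : v ∈ N.nodes (n * S.len) ω)
    (hfree : ω ∉ N.blocked v j (n * S.len) x) (hreq : v ∈ roundRequests S tgt (N.view ω) n) :
    ∀ t ∈ Set.Ico (n * S.len + x) ((n + 1) * S.len), v ∈ N.peers t ω := by
  intro t ht
  refine hN.mem_peers_of_requests hfree hv ht.1 fun t' ht' => ?_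
  rwa [requests_eq_roundRequests hF ⟨ht'.1, ht'.2.trans_lt ht.2⟩]

theorem firstPeer_eq_of_mem_peers (hN : IsP2PNetwork P N) (hS : S.Accommodates x) {u : L} {n : ℕ}
    (hpeer : ∀ t ∈ Set.Ico (n * S.len + x) ((n + 1) * S.len), N.NID u ∈ N.peers t ω) (m : ℕ)
    (hm : (N.view ω).arrival u m ∈
      Set.Ico ((n * S.len + S.warm : ℝ≥0) : ℝ≥0∞) ((n + 1) * S.len : ℝ≥0)) :
    (N.view ω).firstPeer u m = some (N.NID u) := by
  refine hN.firstPeer_eq_of_mem_peers hpeer ⟨le_trans ?_ hm.1, hm.2⟩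
  have hwarm : n * S.len + x + P.maxNodes * P.maxLatency ≤ n * S.len + S.warm := by
    rw [add_assoc]
    gcongr
    exact hS.add_le_warm
  exact_mod_cast hwarm

theorem kept_succ_eq_some_of_message (hN : IsP2PNetwork P N) (hS : S.Accommodates x) {i : Fin r}
    {n : ℕ} (hn : n ∈ Set.Ico (i * S.rounds) ((i + 1) * S.rounds))
    (hpeer : ∀ t ∈ Set.Ico (n * S.len + x) ((n + 1) * S.len), N.NID (tgt i) ∈ N.peers t ω)
    (hmsg : ω ∉ N.silent (tgt i) (n * S.len + S.warm) x) :
    kept S tgt (N.view ω) (n + 1) = some (N.NID (tgt i)) := by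
  have hlen : n * S.len + S.warm + x + P.maxLatency < (n + 1) * S.len :=
    calc n * S.len + S.warm + x + P.maxLatency
        = n * S.len + (S.warm + x + P.maxLatency) := by ring
      _ < n * S.len + S.len := by gcongr; exact hS.add_lt_len
      _ = (n + 1) * S.len := by ring
  have hpeer' : ∀ t ∈ Set.Ico (n * S.len + S.warm) ((n + 1) * S.len),
      N.NID (tgt i) ∈ N.peers t ω := fun t ht =>
    hpeer t ⟨le_trans (by gcongr; exact hS.le_warm) ht.1, ht.2⟩
  have hfirst := hN.exists_firstIn (hN.exists_firstArrival_mem_Ico hlen hpeer' (not_le.1 hmsg))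
  rw [kept_succ hn, heard_eq_some (firstPeer_eq_of_mem_peers hN hS hpeer) hfirst, Option.some_or]

theorem kept_succ_eq_some_of_kept (hN : IsP2PNetwork P N) (hS : S.Accommodates x) {i : Fin r}
    {n : ℕ} (hn : n ∈ Set.Ico (i * S.rounds) ((i + 1) * S.rounds))
    (hpeer : ∀ t ∈ Set.Ico (n * S.len + x) ((n + 1) * S.len), N.NID (tgt i) ∈ N.peers t ω)
    (hk : kept S tgt (N.view ω) n = some (N.NID (tgt i))) :
    kept S tgt (N.view ω) (n + 1) = some (N.NID (tgt i)) := by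
  rw [kept_succ hn, hk]
  rcases heard_eq_none_or_eq_some (firstPeer_eq_of_mem_peers hN hS hpeer) with h | h <;>
    simp [h]

theorem found_eq_some (hN : IsP2PNetwork P N) (hF : (peri S V tgt).Follows N)
    (hS : S.Accommodates x) {i : Fin r} (hv : ∀ t, N.NID (tgt i) ∈ N.nodes t ω)
    {j : Fin (N.slots (N.NID (tgt i)))} (hω : ω ∉ obstructed S tgt N x i j) :
    found S tgt (N.view ω) i = some (N.NID (tgt i)) := by
  simp only [obstructed, Set.mem_union, Set.mem_iUnion, Finset.mem_range, not_or, not_exists]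
    at hω
  obtain ⟨⟨hdraw, hmsg⟩, hfree⟩ := hω
  obtain ⟨m, hm, hdraw⟩ : ∃ m < S.rounds - 1,
      N.oracle ((i * S.rounds + m : ℕ) * S.len) ω = N.NID (tgt i) := by
    simpa [NetworkData.missed] using hdraw
  have hsucc : (i + 1) * S.rounds = i * S.rounds + S.rounds := Nat.succ_mul _ _
  have hle : (i + 1) * S.rounds ≤ r * S.rounds := Nat.mul_le_mul_right _ i.2
  have hpeer {n : ℕ} (hn : n < r * S.rounds) :=
    mem_peers_of_mem_roundRequests hN hF (hv _) (hfree n (by omega))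
  have hstay (n : ℕ) (hn : i * S.rounds + m + 1 + 1 ≤ n) : n ≤ (i + 1) * S.rounds →
      kept S tgt (N.view ω) n = some (N.NID (tgt i)) := by
    induction n, hn using Nat.le_induction with
    | base =>
      intro hn
      exact kept_succ_eq_some_of_message hN hS ⟨by omega, by omega⟩
        (hpeer (by omega) (mem_roundRequests_of_answer (by omega) hdraw)) (hmsg _ (by omega))
    | succ n hmn ih =>
      intro hn
      have hk := ih (by omega)
      exact kept_succ_eq_some_of_kept hN hS ⟨by omega, hn⟩
        (hpeer (by omega) (mem_roundRequests_of_kept (by omega) hk)) hk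
  exact hstay _ (by omega) le_rfl

theorem not_failsAt (hN : IsP2PNetwork P N) (hF : (peri S V tgt).Follows N)
    (hS : S.Accommodates x) (hv : ∀ i t, N.NID (tgt i) ∈ N.nodes t ω)
    {j : ∀ i, Fin (N.slots (N.NID (tgt i)))} (hω : ∀ i, ω ∉ obstructed S tgt N x i (j i)) :
    ¬ (peri S V tgt).FailsAt N tgt ω := by
  have hfound (i : Fin r) := found_eq_some hN hF hS (hv i) (hω i)
  refine not_not.2 ⟨hfound, fun hr i => ?_⟩
  have hfree : ω ∉ N.blocked (N.NID (tgt i)) (j i) ((r * S.rounds : ℕ) * S.len) x := fun h =>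
    hω i (Or.inr (Set.mem_biUnion (Finset.self_mem_range_succ _) h))
  refine hN.mem_peers_of_requests hfree (hv i _) ?_ fun t ht => ?_
  · calc (r * S.rounds : ℕ) * S.len + x ≤ (r * S.rounds : ℕ) * S.len + S.len := by
          gcongr
          exact hS.le_len
      _ = (r * S.rounds + 1) * S.len := by push_cast; ring
  · rw [requests_eq_finalRequests hF ht.1]
    exact mem_finalRequests hfound hr i

end Peri

/-- The sum of the probability bounds for the obstructions to finding one of `r` targets, when a
time `x` is left for getting a slot and for the arrival of a message. -/
noncomputable def PeriSchedule.failureBound {P : NetParams} (S : PeriSchedule P) (r : ℕ)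
    (x : ℝ≥0) : ℝ :=
  Real.exp (-(P.q * (S.rounds - 1 : ℕ))) + r * S.rounds * Real.exp (-(P.nu * x)) +
    (r * S.rounds + 1) * (Real.exp (P.lam * (1 - x)) * (r * S.rounds * S.len + 1))

namespace Peri

variable {P : NetParams} {V L Ω : Type*} [Fintype V] {r : ℕ} {S : PeriSchedule P}
  {tgt : Fin r → L} {N : NetworkData V L Ω} {x : ℝ≥0} [MeasurableSpace Ω] {μ : Measure Ω}
  [IsProbabilityMeasure μ]

theorem measureReal_obstructed_le (hN : IsP2PNetwork P N) (hO : HasOracleLaw P N μ)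
    (hL : IsLive P.lam P.nu N (Set.range tgt) μ) {i : Fin r}
    (hv : ∀ t ω, N.NID (tgt i) ∈ N.nodes t ω) (j : Fin (N.slots (N.NID (tgt i)))) :
    μ.real (obstructed S tgt N x i j) ≤ S.failureBound r x := by
  have hspaced (m : ℕ) : ((i * S.rounds + m : ℕ) : ℝ≥0) * S.len + P.tau ≤
      (i * S.rounds + (m + 1) : ℕ) * S.len :=
    calc _ ≤ ((i * S.rounds + m : ℕ) : ℝ≥0) * S.len + S.len := by gcongr; exact S.tau_le_len
      _ = _ := by push_cast; ring
  refine (measureReal_union_le _ _).trans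
    (add_le_add ((measureReal_union_le _ _).trans (add_le_add ?missed ?silent)) ?blocked)
  case missed => exact hO.measureReal_missed_le hv hspaced _
  case silent =>
    refine (measureReal_biUnion_finset_le _ _).trans_eq ?_
    simp [hL.measureReal_silent (Set.mem_range_self i)]
  case blocked =>
    have hblocked (n : ℕ) (hn : n ∈ Finset.range (r * S.rounds + 1)) :
        μ.real (N.blocked (N.NID (tgt i)) j (n * S.len) x) ≤
          Real.exp (P.lam * (1 - x)) * (r * S.rounds * S.len + 1) := by
      refine (hL.measureReal_blocked_le P.lam_pos hN _ j _ x).trans ?_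
      have hn' : (n : ℝ) ≤ r * S.rounds := by
        exact_mod_cast Finset.mem_range_succ_iff.1 hn
      push_cast
      gcongr
    refine (measureReal_biUnion_finset_le _ _).trans
      ((Finset.sum_le_card_nsmul _ _ _ hblocked).trans_eq ?_)
    simp

theorem measure_failsAt_le (hN : IsP2PNetwork P N) (hO : HasOracleLaw P N μ)
    (hL : IsLive P.lam P.nu N (Set.range tgt) μ) (h0 : ∀ i ω, N.NID (tgt i) ∈ N.nodes 0 ω)
    (hF : (peri S V tgt).Follows N) (hS : S.Accommodates x) :
    μ {ω | (peri S V tgt).FailsAt N tgt ω} ≤ ENNReal.ofReal (r * S.failureBound r x) := by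
  have hv (i : Fin r) (t : ℝ≥0) (ω : Ω) : N.NID (tgt i) ∈ N.nodes t ω :=
    hN.nodes_mono 0 t ω zero_le (h0 i ω)
  let j (i : Fin r) : Fin (N.slots (N.NID (tgt i))) := ⟨0, P.F_pos.trans_le (hN.le_slots _)⟩
  have hsubset : {ω | (peri S V tgt).FailsAt N tgt ω} ⊆ ⋃ i, obstructed S tgt N x i (j i) := by
    intro ω hω
    by_contra hnot
    exact not_failsAt hN hF hS (fun i t => hv i t ω) (by simpa using hnot) hω
  rw [← ofReal_measureReal]
  refine ENNReal.ofReal_le_ofReal ?_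
  calc μ.real {ω | (peri S V tgt).FailsAt N tgt ω}
      ≤ μ.real (⋃ i, obstructed S tgt N x i (j i)) := measureReal_mono hsubset
    _ ≤ ∑ i, μ.real (obstructed S tgt N x i (j i)) := measureReal_iUnion_fintype_le _
    _ ≤ ∑ _ : Fin r, S.failureBound r x := by
        gcongr with i
        exact measureReal_obstructed_le hN hO hL (hv i) (j i)
    _ = r * S.failureBound r x := by simp

end Peri

/-! ### Logarithmic schedules -/

theorem eventually_polynomial_eval_le_exp (p : Polynomial ℝ) {c : ℝ} (hc : 0 < c) :
    ∀ᶠ z in Filter.atTop, p.eval z ≤ Real.exp (c * z) := by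
  have htendsto := ((p.comp (Polynomial.C c⁻¹ * Polynomial.X)).tendsto_div_exp_atTop).comp
    (Filter.tendsto_id.const_mul_atTop hc)
  filter_upwards [htendsto.eventually_le_const one_pos] with z hz
  rw [Function.comp_apply, div_le_one (Real.exp_pos _)] at hz
  simpa [inv_mul_cancel_left₀ hc.ne'] using hz

theorem sq_one_add_log_le {X : ℝ} (hX : 1 ≤ X) : (1 + Real.log X) ^ 2 ≤ 4 * X := by
  have hX0 : 0 < X := one_pos.trans_le hX
  have hlog : 0 ≤ Real.log X := Real.log_nonneg hX
  have hsqrt : 1 + Real.log X ≤ 2 * √X := by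
    have h := Real.log_le_sub_one_of_pos (Real.sqrt_pos.2 hX0)
    rw [Real.log_sqrt hX0.le] at h
    linarith
  calc (1 + Real.log X) ^ 2 ≤ (2 * √X) ^ 2 := by gcongr
    _ = 4 * X := by rw [mul_pow, Real.sq_sqrt hX0.le]; norm_num

theorem mul_sq_one_add_log_div_le {r ε ε₀ : ℝ} (hr : 1 ≤ r) (hε : 0 < ε) (hεε₀ : ε ≤ ε₀)
    (hε₀ : ε₀ < 1) :
    r * (1 + Real.log (r / ε)) ^ 2 ≤ 4 / (1 - ε₀) ^ 2 * (r ^ 2 * ε⁻¹ * Real.log ε⁻¹ ^ 2) := by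
  have hX : 1 ≤ r / ε := (one_le_div hε).2 (by linarith)
  have hlog : 1 - ε₀ ≤ Real.log ε⁻¹ := by
    have h := Real.one_sub_inv_le_log_of_pos (inv_pos.2 hε)
    rw [inv_inv] at h
    linarith
  have hgap : 0 < 1 - ε₀ := sub_pos.2 hε₀
  calc r * (1 + Real.log (r / ε)) ^ 2 ≤ r * (4 * (r / ε)) := by
        gcongr
        exact sq_one_add_log_le hX
    _ = 4 / (1 - ε₀) ^ 2 * (r ^ 2 * ε⁻¹ * (1 - ε₀) ^ 2) := by field_simp
    _ ≤ _ := by gcongr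

namespace NetParams

/-- The length of a round in excess of `2 * x`, where `x` is the time that the round has to
accommodate. -/
def roundOverhead (P : NetParams) : ℝ≥0 :=
  (P.k - 1 : ℕ) * P.tau + (P.maxNodes + 1) * P.maxLatency + 1

/-- The schedule of about `x` rounds per target, each of which accommodates `x`. It is used for
`x` proportional to `1 + log (r / ε)`. -/
noncomputable def schedule (P : NetParams) (x : ℝ≥0) : PeriSchedule P where
  rounds := ⌈x⌉₊ + 1
  len := 2 * x + P.roundOverhead
  warm := x + P.maxNodes * P.maxLatency
  len_pos := lt_of_lt_of_le one_pos (le_add_self.trans le_add_self)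
  queries_le := by
    rw [roundOverhead, add_assoc (_ * P.tau)]
    exact le_self_add.trans le_add_self

/-- The rate at which the probability of the least unlikely kind of obstruction decays. -/
noncomputable def minRate (P : NetParams) : ℝ :=
  min P.lam (min P.nu P.q)

/-- The value at `x` of this polynomial bounds the factor in front of `exp (-minRate * x)` in
`(P.schedule x).failureBound r x`, up to a factor `r ^ 2`. -/
noncomputable def failurePolynomial (P : NetParams) : Polynomial ℝ :=
  1 + (.X + 2) + (.X + 3) * (.C (Real.exp P.lam) * ((.X + 2) * (2 * .X + .C ↑P.roundOverhead) + 1))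

variable (P : NetParams)

theorem minRate_pos : 0 < P.minRate :=
  lt_min P.lam_pos (lt_min (by exact_mod_cast P.nu_pos) (by exact_mod_cast P.q_pos))

theorem accommodates_schedule (x : ℝ≥0) : (P.schedule x).Accommodates x where
  add_le_warm := le_rfl
  add_lt_len :=
    calc x + P.maxNodes * P.maxLatency + x + P.maxLatency
        = 2 * x + (P.maxNodes + 1) * P.maxLatency := by ring
      _ < 2 * x + ((P.maxNodes + 1) * P.maxLatency + 1) := by
          gcongr
          exact lt_add_one _
      _ ≤ 2 * x + P.roundOverhead := by
          rw [roundOverhead, add_assoc (_ * P.tau)]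
          exact add_le_add_right le_add_self _

theorem rounds_schedule_le (x : ℝ≥0) : ((P.schedule x).rounds : ℝ) ≤ x + 2 := by
  have hceil : (⌈x⌉₊ : ℝ) < x + 1 := by exact_mod_cast Nat.ceil_lt_add_one x.2
  simp only [schedule, Nat.cast_add, Nat.cast_one]
  linarith

theorem horizon_schedule_le {V L : Type*} {r : ℕ} (hr : 0 < r) (tgt : Fin r → L) (x : ℝ≥0) :
    ((peri (P.schedule x) V tgt).horizon : ℝ) ≤ r * (x + 3) * (2 * x + P.roundOverhead) := by
  have hr1 : (1 : ℝ) ≤ r := by exact_mod_cast hr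
  have hrounds := P.rounds_schedule_le x
  calc ((peri (P.schedule x) V tgt).horizon : ℝ)
      = (r * (P.schedule x).rounds + 1) * (2 * x + P.roundOverhead) := by
        simp [peri, schedule]
    _ ≤ (r * (x + 2) + r) * (2 * x + P.roundOverhead) := by gcongr
    _ = _ := by ring

theorem failureBound_schedule_le {r : ℕ} {X : ℝ} (hX : 1 ≤ X) (hr : r ≤ X) (x : ℝ≥0) :
    (P.schedule x).failureBound r x ≤
      X ^ 2 * (P.failurePolynomial.eval (x : ℝ) * Real.exp (-(P.minRate * x))) := by
  set R := (P.schedule x).rounds with hR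
  set E := Real.exp (-(P.minRate * x)) with hE
  have hRx : (R : ℝ) ≤ x + 2 := P.rounds_schedule_le x
  have hxR : (x : ℝ) ≤ (R - 1 : ℕ) := by exact_mod_cast Nat.le_ceil x
  have hrR : r * R ≤ X * (x + 2) := by gcongr
  have hq : Real.exp (-(P.q * (R - 1 : ℕ))) ≤ E := by
    rw [hE]
    gcongr
    exact (min_le_right _ _).trans (min_le_right _ _)
  have hnu : Real.exp (-(P.nu * x)) ≤ E := by
    rw [hE]
    gcongr
    exact (min_le_right _ _).trans (min_le_left _ _)
  have hlam : Real.exp (P.lam * (1 - x)) ≤ Real.exp P.lam * E := by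
    rw [hE, ← Real.exp_add, mul_one_sub, sub_eq_add_neg]
    gcongr
    exact min_le_left _ _
  calc (P.schedule x).failureBound r x
      = Real.exp (-(P.q * (R - 1 : ℕ))) + r * R * Real.exp (-(P.nu * x)) + (r * R + 1) *
          (Real.exp (P.lam * (1 - x)) * (r * R * (2 * x + P.roundOverhead) + 1)) := by
        simp [PeriSchedule.failureBound, schedule, hR]
    _ ≤ E + X * (x + 2) * E + (X * (x + 2) + X) *
          (Real.exp P.lam * E * (X * (x + 2) * (2 * x + P.roundOverhead) + X)) := by gcongr
    _ ≤ X ^ 2 * E + X ^ 2 * (x + 2) * E + (X * (x + 2) + X) *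
          (Real.exp P.lam * E * (X * (x + 2) * (2 * x + P.roundOverhead) + X)) := by
        gcongr
        · exact le_mul_of_one_le_left (Real.exp_nonneg _) (one_le_pow₀ hX)
        · exact le_self_pow₀ hX two_ne_zero
    _ = X ^ 2 * (P.failurePolynomial.eval (x : ℝ) * E) := by
        simp [failurePolynomial]
        ring

theorem exists_failureBound_schedule_le :
    ∃ b : ℝ≥0, ∀ {r : ℕ} {X : ℝ} {x : ℝ≥0}, 1 ≤ X → r ≤ X → b * (1 + Real.log X) ≤ x →
      (P.schedule x).failureBound r x ≤ X⁻¹ := by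
  have hθ := P.minRate_pos
  obtain ⟨z, hz⟩ := Filter.eventually_atTop.1
    (eventually_polynomial_eval_le_exp P.failurePolynomial (half_pos hθ))
  refine ⟨(max z (6 / P.minRate)).toNNReal, fun {r X x} hX hr hx => ?_⟩
  rw [Real.coe_toNNReal _ (le_max_of_le_right (by positivity))] at hx
  have hX0 : 0 < X := one_pos.trans_le hX
  have hlog : 0 ≤ Real.log X := Real.log_nonneg hX
  have hzx : z ≤ x := by
    refine (le_max_left z (6 / P.minRate)).trans (le_trans ?_ hx)
    exact le_mul_of_one_le_right (le_max_of_le_right (by positivity)) (by linarith)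
  have hlogx : (3 : ℕ) * Real.log X ≤ P.minRate / 2 * x :=
    calc (3 : ℕ) * Real.log X ≤ P.minRate / 2 * (6 / P.minRate * (1 + Real.log X)) := by
          field_simp
          norm_num
          linarith
      _ ≤ P.minRate / 2 * x := by
          gcongr
          exact le_trans (by gcongr; exact le_max_right _ _) hx
  have hX3 : X ^ 3 ≤ Real.exp (P.minRate / 2 * x) := by
    rwa [← Real.log_le_iff_le_exp (by positivity), Real.log_pow]
  rw [← one_div, le_div_iff₀ hX0]
  calc (P.schedule x).failureBound r x * X
      ≤ X ^ 2 * (P.failurePolynomial.eval (x : ℝ) * Real.exp (-(P.minRate * x))) * X := by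
        gcongr
        exact P.failureBound_schedule_le hX hr x
    _ = X ^ 3 * P.failurePolynomial.eval (x : ℝ) * Real.exp (-(P.minRate * x)) := by ring
    _ ≤ X ^ 3 * Real.exp (P.minRate / 2 * x) * Real.exp (-(P.minRate * x)) := by
        gcongr
        exact hz x hzx
    _ ≤ Real.exp (P.minRate / 2 * x) * Real.exp (P.minRate / 2 * x) *
          Real.exp (-(P.minRate * x)) := by gcongr
    _ = 1 := by
        rw [← Real.exp_add, ← Real.exp_add, Real.exp_eq_one_iff]
        ring

end NetParams

theorem mainTheorem1_general (P : NetParams) :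
    ∃ C : ℝ, 0 < C ∧ ∀ (r : ℕ) (ε : ℝ), 0 < r → 0 < ε → ε ≤ 1 →
      ∃ S : PeriSchedule P,
        ∀ (V L : Type*) [Fintype V] (tgt : Fin r → L),
          ((peri S V tgt).horizon : ℝ) ≤ C * (r * (1 + Real.log (r / ε)) ^ 2) ∧
          ∀ (Ω : Type*) [MeasurableSpace Ω] (μ : Measure Ω) [IsProbabilityMeasure μ]
            (N : NetworkData V L Ω),
            IsP2PNetwork P N →
            HasOracleLaw P N μ →
            IsLive P.lam P.nu N (Set.range tgt) μ →
            (∀ i ω, N.NID (tgt i) ∈ N.nodes 0 ω) →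
            (peri S V tgt).Follows N →
            μ {ω | (peri S V tgt).FailsAt N tgt ω} ≤ ENNReal.ofReal ε := by
  obtain ⟨b, hb⟩ := P.exists_failureBound_schedule_le
  have hK : 0 < P.roundOverhead := lt_of_lt_of_le one_pos le_add_self
  refine ⟨(b + 3) * (2 * b + P.roundOverhead), by positivity, fun r ε hr hε hε1 => ?_⟩
  have hr1 : (1 : ℝ) ≤ r := by exact_mod_cast hr
  have hrX : (r : ℝ) ≤ r / ε := le_div_self (by positivity) hε hε1
  have hlog : 0 ≤ Real.log (r / ε) := Real.log_nonneg (hr1.trans hrX)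
  set ℓ : ℝ := 1 + Real.log (r / ε)
  have hℓ1 : 1 ≤ ℓ := by linarith
  let x : ℝ≥0 := b * ℓ.toNNReal
  have hx : (x : ℝ) = b * ℓ := by simp [x, zero_le_one.trans hℓ1]
  refine ⟨P.schedule x, fun V L _ tgt => ⟨?_, fun Ω _ μ _ N hN hO hL h0 hF => ?_⟩⟩
  · calc ((peri (P.schedule x) V tgt).horizon : ℝ)
        ≤ r * (x + 3) * (2 * x + P.roundOverhead) := P.horizon_schedule_le hr tgt x
      _ ≤ r * (b * ℓ + 3 * ℓ) * (2 * (b * ℓ) + P.roundOverhead * ℓ) := by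
          rw [hx]
          gcongr
          · linarith
          · exact le_mul_of_one_le_right (by positivity) hℓ1
      _ = (b + 3) * (2 * b + P.roundOverhead) * (r * ℓ ^ 2) := by ring
  · refine (Peri.measure_failsAt_le hN hO hL h0 hF (P.accommodates_schedule x)).trans
      (ENNReal.ofReal_le_ofReal ?_)
    calc r * (P.schedule x).failureBound r x ≤ r * (r / ε)⁻¹ := by
          gcongr
          exact hb (hr1.trans hrX) hrX hx.ge
      _ = ε := by field_simp

theorem mainTheorem1 (P : NetParams) (ε₀ : ℝ) (hε₀ : ε₀ < 1) :
    ∃ C : ℝ, 0 < C ∧ ∀ (r : ℕ) (ε : ℝ), 0 < r → 0 < ε → ε ≤ ε₀ →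
      ∃ S : PeriSchedule P,
        ∀ (V L : Type*) [Fintype V] (tgt : Fin r → L),
          ((peri S V tgt).horizon : ℝ) ≤ C * (r : ℝ) ^ 2 * ε⁻¹ * Real.log ε⁻¹ ^ 2 ∧
          ∀ (Ω : Type*) [MeasurableSpace Ω] (μ : Measure Ω) [IsProbabilityMeasure μ]
            (N : NetworkData V L Ω),
            IsP2PNetwork P N →
            HasOracleLaw P N μ →
            IsLive P.lam P.nu N (Set.range tgt) μ →
            Function.Injective (fun i => N.NID (tgt i)) →
            (∀ i ω, N.NID (tgt i) ∈ N.nodes 0 ω) →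
            (peri S V tgt).Follows N →
            μ {ω | (peri S V tgt).FailsAt N tgt ω} ≤ ENNReal.ofReal ε := by
  obtain ⟨C, hC, h⟩ := mainTheorem1_general P
  refine ⟨C * (4 / (1 - ε₀) ^ 2), by positivity, fun r ε hr hε hεε₀ => ?_⟩
  obtain ⟨S, hS⟩ := h r ε hr hε (hεε₀.trans hε₀.le)
  refine ⟨S, fun V L _ tgt => ⟨(hS V L tgt).1.trans ?_, fun Ω _ μ _ N hN hO hL _ =>
    (hS V L tgt).2 Ω μ N hN hO hL⟩⟩
  calc C * (r * (1 + Real.log (r / ε)) ^ 2)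
      ≤ C * (4 / (1 - ε₀) ^ 2 * (r ^ 2 * ε⁻¹ * Real.log ε⁻¹ ^ 2)) :=
        mul_le_mul_of_nonneg_left
          (mul_sq_one_add_log_div_le (Nat.one_le_cast.2 hr) hε hεε₀ hε₀) hC.le
    _ = _ := by ring
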